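/- Let $\Theta$ be a finite simple oriented graph with vertex set $[n]=\{1,\dots,n\}$, i.e. a finite oriented graph with no multiple arrows and no oriented cycles of length one or two; write $i\to j$ if there is an arrow from $i$ to $j$, and call $i\neq j$ \emph{not connected} if neither $i\to j$ nor $j\to i$. Let $\mathrm{HK}_\Theta$ be the monoid generated by idempotents $x_1,\dots,x_n$ subject to the relations $x_ix_j=x_jx_i$ if $i$ and $j$ are not connected, and $x_ix_jx_i=x_jx_ix_j=x_ix_j$ if $i\to j$. The content of an element of $\mathrm{HK}_\Theta$ is the set of indices $i$ such that $x_i$ occurs in a word representing it (this does not depend on the word). Let $A_\Theta$ be the set of all $X\subseteq[n]$ such that the full subgraph of $\Theta$ on $X$ contains no oriented cycles; for $X\in A_\Theta$ let $e_X$ be the unique idempotent of $\mathrm{HK}_\Theta$ with content $X$. For $X,Y\in A_\Theta$, say that $p(X,Y)$ holds if there do not exist $b\in Y\setminus X$, $a\in X\setminus Y$, $r\ge 0$ and $i_1,\dots,i_r\in X\cap Y$ with $b\to i_1\to\dots\to i_r\to a$ (for $r=0$ this means $b\to a$). **Theorem.** A map $\varphi:\{x_1,\dots,x_n\}\to\mathrm{HK}_\Theta$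 extends to a monoid endomorphism of $\mathrm{HK}_\Theta$ if and only if there exist sets $X_1,\dots,X_n\subseteq[n]$ such that, for all $i,j\in[n]$: 1. $X_i\in A_\Theta$; 2. $\varphi(x_i)=e_{X_i}$; 3. $p(X_i,X_j)$ and $p(X_j,X_i)$ hold if $i$ and $j$ are not connected; 4. $p(X_i,X_j)$ holds if $i\to j$. -/

import Mathlib

namespace HeckeKiselman

/-- A digraph is a simple oriented graph if it has no oriented cycles of length one or two
(multiple arrows are impossible for a `Digraph`). -/
structure IsSimpleOriented {V : Type*} (Θ : Digraph V) : Prop where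
  no_loop : ∀ i, ¬ Θ.Adj i i
  no_two_cycle : ∀ i j, Θ.Adj i j → ¬ Θ.Adj j i

/-- Two distinct vertices are not connected if there is no arrow between them. -/
def Disconnected {V : Type*} (Θ : Digraph V) (i j : V) : Prop :=
  i ≠ j ∧ ¬ Θ.Adj i j ∧ ¬ Θ.Adj j i

/-- The defining relations of the Hecke--Kiselman monoid. -/
inductive Rel {V : Type*} (Θ : Digraph V) : FreeMonoid V → FreeMonoid V → Prop
  | idem (i : V) : Rel Θ (.of i * .of i) (.of i)
  | comm (i j : V) (h : Disconnected Θ i j) : Rel Θ (.of i * .of j) (.of j * .of i)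
  | braid_left (i j : V) (h : Θ.Adj i j) :
      Rel Θ (.of i * .of j * .of i) (.of i * .of j)
  | braid_right (i j : V) (h : Θ.Adj i j) :
      Rel Θ (.of j * .of i * .of j) (.of i * .of j)

/-- The Hecke--Kiselman monoid of `Θ`. -/
abbrev HK {V : Type*} (Θ : Digraph V) : Type _ := PresentedMonoid (Rel Θ)

/-- The generator `x_i`. -/
def gen {V : Type*} (Θ : Digraph V) (i : V) : HK Θ := PresentedMonoid.of (Rel Θ) i

/-- The set of letters that occur in a word. -/
def wordContent {V : Type*} [DecidableEq V] (w : FreeMonoid V) : Finset V :=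
  w.toList.toFinset

theorem wordContent_mul {V : Type*} [DecidableEq V] (u v : FreeMonoid V) :
    wordContent (u * v) = wordContent u ∪ wordContent v := by
  simp [wordContent]

theorem wordContent_eq_of_conGen {V : Type*} [DecidableEq V] (Θ : Digraph V)
    (u v : FreeMonoid V) (h : conGen (Rel Θ) u v) : wordContent u = wordContent v := by
  let c : Con (FreeMonoid V) :=
    { r := fun u v => wordContent u = wordContent v
      iseqv := ⟨fun _ => rfl, fun h => h.symm, fun h h' => h.trans h'⟩
      mul' := fun {a b a' b'} h h' => by
        change wordContent a = wordContent b at h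
        change wordContent a' = wordContent b' at h'
        rw [wordContent_mul, wordContent_mul, h, h'] }
  have hle : conGen (Rel Θ) ≤ c := by
    refine Con.conGen_le.2 ?_
    intro a b hab
    change wordContent a = wordContent b
    cases hab <;> ext k <;> simp [wordContent] <;> tauto
  exact hle h

/-- The content of an element of the Hecke--Kiselman monoid: the set of indices of the
generators that occur in any word representing it. -/
def content {V : Type*} [DecidableEq V] {Θ : Digraph V} (x : HK Θ) : Finset V :=
  Quotient.lift (s := (conGen (Rel Θ)).toSetoid) wordContent
    (fun u v h => wordContent_eq_of_conGen Θ u v h) x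

/-- `IsAcyclicOn Θ X` says that the full subgraph of `Θ` on `X` contains no oriented cycles,
i.e. no directed closed walk of positive length. The family of all such `X` is `A_Θ`. -/
def IsAcyclicOn {V : Type*} (Θ : Digraph V) (X : Finset V) : Prop :=
  ∀ i, ¬ Relation.TransGen (fun a b => a ∈ X ∧ b ∈ X ∧ Θ.Adj a b) i i

/-- The predicate `p(X, Y)`: there are no `b ∈ Y \ X`, `a ∈ X \ Y` and a (possibly empty)
list `i_1, …, i_r` of vertices in `X ∩ Y` with `b → i_1 → ⋯ → i_r → a`. -/
def p {V : Type*} [DecidableEq V] (Θ : Digraph V) (X Y : Finset V) : Prop :=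
  ¬ ∃ b ∈ Y \ X, ∃ a ∈ X \ Y, ∃ l : List V,
    (∀ i ∈ l, i ∈ X ∩ Y) ∧ List.IsChain Θ.Adj (b :: (l ++ [a]))

section Idempotents

variable {V : Type*} {Θ : Digraph V}

theorem gen_idem (a : V) : gen Θ a * gen Θ a = gen Θ a :=
  PresentedMonoid.mk_eq_mk_of_rel (Rel.idem (Θ := Θ) a)

theorem gen_comm {a b : V} (h : Disconnected Θ a b) :
    gen Θ a * gen Θ b = gen Θ b * gen Θ a :=
  PresentedMonoid.mk_eq_mk_of_rel (Rel.comm a b h)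

theorem gen_braid_left {a b : V} (h : Θ.Adj a b) :
    gen Θ a * gen Θ b * gen Θ a = gen Θ a * gen Θ b :=
  PresentedMonoid.mk_eq_mk_of_rel (Rel.braid_left a b h)

theorem gen_braid_right {a b : V} (h : Θ.Adj a b) :
    gen Θ b * gen Θ a * gen Θ b = gen Θ a * gen Θ b :=
  PresentedMonoid.mk_eq_mk_of_rel (Rel.braid_right a b h)

/-- The element represented by a word, given as a list of letters. -/
def ofList (Θ : Digraph V) (l : List V) : HK Θ := (l.map (gen Θ)).prod

theorem mk_eq_ofList (w : FreeMonoid V) :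
    PresentedMonoid.mk (Rel Θ) w = ofList Θ w.toList := by
  induction w with
  | one => rfl
  | of a => simp [ofList, gen, PresentedMonoid.of]
  | mul u v hu hv => simp [ofList, hu, hv]

theorem content_ofList [DecidableEq V] (l : List V) : content (ofList Θ l) = l.toFinset := by
  have h := mk_eq_ofList (Θ := Θ) (FreeMonoid.ofList l)
  rw [FreeMonoid.toList_ofList] at h
  rw [← h]
  rfl

theorem exists_ofList (y : HK Θ) : ∃ l, y = ofList Θ l := by
  obtain ⟨w, rfl⟩ := PresentedMonoid.surjective_mk y
  exact ⟨_, mk_eq_ofList w⟩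

theorem ofList_cons (a : V) (l : List V) : ofList Θ (a :: l) = gen Θ a * ofList Θ l := by
  simp [ofList]

theorem ofList_append (l l' : List V) : ofList Θ (l ++ l') = ofList Θ l * ofList Θ l' := by
  simp [ofList]

theorem cancel_right (a : V) (l : List V) (h : ∀ b ∈ l, ¬ Θ.Adj b a) :
    gen Θ a * ofList Θ l * gen Θ a = gen Θ a * ofList Θ l := by
  induction l with
  | nil => simp [ofList, gen_idem]
  | cons b l ih =>
    have ih := ih (fun c hc => h c (List.mem_cons_of_mem _ hc))
    have hb := h b List.mem_cons_self
    rw [ofList_cons]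
    by_cases hba : b = a
    · subst hba
      rw [← mul_assoc, gen_idem, ih]
    · by_cases hab : Θ.Adj a b
      · have e := gen_braid_left hab
        calc gen Θ a * (gen Θ b * ofList Θ l) * gen Θ a
            = (gen Θ a * gen Θ b) * ofList Θ l * gen Θ a := by simp only [mul_assoc]
          _ = (gen Θ a * gen Θ b) * (gen Θ a * ofList Θ l * gen Θ a) := by
              conv_lhs => rw [← e]
              simp only [mul_assoc]
          _ = (gen Θ a * gen Θ b * gen Θ a) * ofList Θ l := by rw [ih]; simp only [mul_assoc]
          _ = _ := by rw [e]; simp only [mul_assoc]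
      · have e := gen_comm (Θ := Θ) (a := a) (b := b) ⟨fun h => hba h.symm, hab, hb⟩
        calc gen Θ a * (gen Θ b * ofList Θ l) * gen Θ a
            = (gen Θ a * gen Θ b) * ofList Θ l * gen Θ a := by simp only [mul_assoc]
          _ = gen Θ b * (gen Θ a * ofList Θ l * gen Θ a) := by rw [e]; simp only [mul_assoc]
          _ = (gen Θ b * gen Θ a) * ofList Θ l := by rw [ih]; simp only [mul_assoc]
          _ = _ := by rw [← e]; simp only [mul_assoc]

theorem cancel_left (a : V) (l : List V) (h : ∀ b ∈ l, ¬ Θ.Adj a b) :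
    gen Θ a * ofList Θ l * gen Θ a = ofList Θ l * gen Θ a := by
  induction l using List.reverseRecOn with
  | nil => simp [ofList, gen_idem]
  | append_singleton l b ih =>
    have ih := ih (fun c hc => h c (List.mem_append_left _ hc))
    have hb := h b (by simp)
    have hs : ofList Θ [b] = gen Θ b := by simp [ofList]
    rw [ofList_append, hs]
    by_cases hba : b = a
    · subst hba
      rw [← mul_assoc, ih, mul_assoc, gen_idem]
    · by_cases hab : Θ.Adj b a
      · have e := gen_braid_right hab
        calc gen Θ a * (ofList Θ l * gen Θ b) * gen Θ a
            = gen Θ a * ofList Θ l * (gen Θ b * gen Θ a) := by simp only [mul_assoc]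
          _ = (gen Θ a * ofList Θ l * gen Θ a) * (gen Θ b * gen Θ a) := by
              rw [← e]; simp only [← mul_assoc]; simp only [mul_assoc, gen_idem]
          _ = ofList Θ l * (gen Θ a * gen Θ b * gen Θ a) := by rw [ih]; simp only [mul_assoc]
          _ = _ := by rw [e]; simp only [mul_assoc]
      · have e := gen_comm (Θ := Θ) (a := a) (b := b) ⟨fun h => hba h.symm, hb, hab⟩
        calc gen Θ a * (ofList Θ l * gen Θ b) * gen Θ a
            = gen Θ a * ofList Θ l * (gen Θ b * gen Θ a) := by simp only [mul_assoc]
          _ = (gen Θ a * ofList Θ l * gen Θ a) * gen Θ b := by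
              rw [← e]; simp only [mul_assoc]
          _ = ofList Θ l * (gen Θ a * gen Θ b) := by rw [ih]; simp only [mul_assoc]
          _ = _ := by rw [e]; simp only [mul_assoc]

theorem IsAcyclicOn.mono {X Y : Finset V} (h : IsAcyclicOn Θ X) (hYX : Y ⊆ X) :
    IsAcyclicOn Θ Y := fun i hi =>
  h i (Relation.TransGen.mono (fun _ _ hab => ⟨hYX hab.1, hYX hab.2.1, hab.2.2⟩) i i hi)

/-- Vertices of a finite acyclic full subgraph can be treated in an order in which the targets
of arrows come first. -/
theorem IsAcyclicOn.wellFounded [Finite V] {X : Finset V} (h : IsAcyclicOn Θ X) :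
    WellFounded (fun b a => a ∈ X ∧ b ∈ X ∧ Θ.Adj a b) := by
  let T : V → V → Prop :=
    fun b a => Relation.TransGen (fun a b => a ∈ X ∧ b ∈ X ∧ Θ.Adj a b) a b
  have : IsTrans V T := ⟨fun _ _ _ hab hbc => Relation.TransGen.trans hbc hab⟩
  have : Std.Irrefl T := ⟨h⟩
  have hT : WellFounded T := Finite.wellFounded_of_trans_of_irrefl T
  refine Subrelation.wf ?_ hT
  intro b a hab
  exact Relation.TransGen.single hab

theorem IsAcyclicOn.exists_absorbing [Finite V] [DecidableEq V] (X : Finset V)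
    (h : IsAcyclicOn Θ X) : ∃ l : List V, l.toFinset = X ∧
      ∀ a ∈ X, gen Θ a * ofList Θ l = ofList Θ l ∧ ofList Θ l * gen Θ a = ofList Θ l := by
  induction X using Finset.strongInduction with
  | H X ih =>
    rcases X.eq_empty_or_nonempty with rfl | hne
    · exact ⟨[], rfl, by simp⟩
    obtain ⟨b, hb, hmin⟩ := h.wellFounded.has_min (X : Set V) hne
    have hb : b ∈ X := hb
    have hsink : ∀ c ∈ X, ¬ Θ.Adj b c := fun c hc hbc => hmin c hc ⟨hb, hc, hbc⟩
    obtain ⟨l, hl, habs⟩ := ih (X.erase b) (Finset.erase_ssubset hb)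
      (h.mono (Finset.erase_subset b X))
    have hlX : ∀ c ∈ l, c ∈ X := fun c hc =>
      Finset.mem_of_mem_erase (hl ▸ List.mem_toFinset.2 hc)
    have hs : ofList Θ (l ++ [b]) = ofList Θ l * gen Θ b := by simp [ofList]
    refine ⟨l ++ [b], ?_, ?_⟩
    · ext k
      simp only [List.toFinset_append, hl, Finset.mem_union, Finset.mem_erase,
        List.mem_toFinset, List.mem_singleton]
      constructor
      · rintro (hk | rfl)
        exacts [hk.2, hb]
      · intro hk
        by_cases hkb : k = b
        exacts [Or.inr hkb, Or.inl ⟨hkb, hk⟩]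
    · intro a ha
      rw [hs]
      by_cases hab : a = b
      · subst hab
        refine ⟨?_, by rw [mul_assoc, gen_idem]⟩
        rw [← mul_assoc]
        exact cancel_left a l (fun c hc => hsink c (hlX c hc))
      · obtain ⟨h1, h2⟩ := habs a (Finset.mem_erase.2 ⟨hab, ha⟩)
        refine ⟨by rw [← mul_assoc, h1], ?_⟩
        have e : gen Θ a * gen Θ b * gen Θ a = gen Θ a * gen Θ b := by
          have := cancel_right (Θ := Θ) a [b] (by simpa using hsink a ha)
          simpa [ofList] using this
        calc ofList Θ l * gen Θ b * gen Θ a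
            = ofList Θ l * (gen Θ a * gen Θ b * gen Θ a) := by
              conv_lhs => rw [← h2]
              simp only [mul_assoc]
          _ = _ := by rw [e, ← mul_assoc, h2]

theorem IsAcyclicOn.gen_mul_idempotent [Finite V] [DecidableEq V] {X : Finset V}
    (h : IsAcyclicOn Θ X) {e : HK Θ} (he : IsIdempotentElem e) (hc : content e = X)
    (a : V) (ha : a ∈ X) : ∀ u : List V, (∀ c ∈ u, c ∈ X) →
      gen Θ a * ofList Θ u * e = ofList Θ u * e := by
  classical
  induction a using h.wellFounded.induction with
  | h a ih =>
    have hdel : ∀ (u : List V) (s : HK Θ), (∃ v : List V, (∀ c ∈ v, c ∈ X) ∧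
        s = ofList Θ v * e) → (∀ c ∈ u, c ∈ X) →
        ofList Θ u * s = ofList Θ (u.filter (fun d => ¬ Θ.Adj a d)) * s := by
      rintro u s ⟨v, hv, rfl⟩ hu
      induction u with
      | nil => rfl
      | cons d u ihu =>
        have ihu := ihu (fun c hc => hu c (List.mem_cons_of_mem _ hc))
        have hd := hu d List.mem_cons_self
        by_cases had : Θ.Adj a d
        · rw [List.filter_cons_of_neg (by simpa using had), ← ihu, ofList_cons]
          have := ih d ⟨ha, hd, had⟩ hd (u ++ v) (by
            intro c hc
            rcases List.mem_append.1 hc with hc | hc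
            exacts [hu c (List.mem_cons_of_mem _ hc), hv c hc])
          rw [ofList_append] at this
          simpa only [mul_assoc] using this
        · rw [List.filter_cons_of_pos (by simpa using had), ofList_cons, ofList_cons,
            mul_assoc, ihu, mul_assoc]
    obtain ⟨w, hw⟩ := exists_ofList e
    have hwX : w.toFinset = X := by rw [← content_ofList (Θ := Θ), ← hw, hc]
    have hwmem : ∀ c ∈ w, c ∈ X := fun c hc => hwX ▸ List.mem_toFinset.2 hc
    have haw : a ∈ w := List.mem_toFinset.1 (hwX.symm ▸ ha)
    obtain ⟨w₁, w₂, rfl⟩ := List.append_of_mem haw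
    have hw₂ : ∀ c ∈ a :: w₂, c ∈ X := fun c hc => hwmem c (List.mem_append_right _ hc)
    intro u hu
    have hmem : ∀ c ∈ u ++ w₁, c ∈ X := by
      intro c hc
      rcases List.mem_append.1 hc with hc | hc
      exacts [hu c hc, hwmem c (List.mem_append_left _ hc)]
    have hee : e = ofList Θ w₁ * (ofList Θ (a :: w₂) * e) := by
      conv_lhs => rw [← he.eq]
      conv_lhs => enter [1]; rw [hw, ofList_append]
      rw [mul_assoc]
    have key : ofList Θ u * e = ofList Θ ((u ++ w₁).filter (fun d => ¬ Θ.Adj a d)) *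
        (ofList Θ (a :: w₂) * e) := by
      rw [← hdel _ _ ⟨_, hw₂, rfl⟩ hmem, ofList_append, mul_assoc, ← hee]
    have hcan := cancel_left (Θ := Θ) a ((u ++ w₁).filter (fun d => ¬ Θ.Adj a d))
      (fun b hb => by simpa using (List.mem_filter.1 hb).2)
    rw [mul_assoc, key, ofList_cons, mul_assoc (gen Θ a), ← mul_assoc (ofList Θ _) (gen Θ a),
      ← mul_assoc, ← mul_assoc (gen Θ a), hcan]

/-- Every vertex set whose full subgraph is acyclic is the content of exactly one idempotent. -/
theorem IsAcyclicOn.existsUnique_idempotent [Finite V] [DecidableEq V] {X : Finset V}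
    (h : IsAcyclicOn Θ X) : ∃! e : HK Θ, IsIdempotentElem e ∧ content e = X := by
  obtain ⟨l, hl, habs⟩ := h.exists_absorbing
  have hlX : ∀ c ∈ l, c ∈ X := fun c hc => hl ▸ List.mem_toFinset.2 hc
  have hright : ∀ u : List V, (∀ c ∈ u, c ∈ X) → ofList Θ l * ofList Θ u = ofList Θ l := by
    intro u hu
    induction u with
    | nil => simp [ofList]
    | cons a u ih =>
      rw [ofList_cons, ← mul_assoc, (habs a (hu a List.mem_cons_self)).2,
        ih (fun c hc => hu c (List.mem_cons_of_mem _ hc))]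
  refine ⟨ofList Θ l, ⟨hright l hlX, by rw [content_ofList, hl]⟩, ?_⟩
  rintro e ⟨he, hc⟩
  have hleft : ∀ u : List V, (∀ c ∈ u, c ∈ X) → ofList Θ u * e = e := by
    intro u hu
    induction u with
    | nil => simp [ofList]
    | cons a u ih =>
      have ha := h.gen_mul_idempotent he hc a (hu a List.mem_cons_self) []
        (by simp)
      rw [ofList_cons, mul_assoc, ih (fun c hc => hu c (List.mem_cons_of_mem _ hc))]
      simpa [ofList] using ha
  obtain ⟨w, hw⟩ := exists_ofList e
  have hwX : w.toFinset = X := by rw [← content_ofList (Θ := Θ), ← hw, hc]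
  rw [← hleft l hlX, hw, hright w (fun c hc => hwX ▸ List.mem_toFinset.2 hc)]

end Idempotents

/-- The idempotent `e_X`: the unique idempotent with content `X`, for `X` in `A_Θ`. -/
noncomputable def idem {V : Type*} [Finite V] [DecidableEq V] (Θ : Digraph V) (X : Finset V)
    (h : IsAcyclicOn Θ X) : HK Θ :=
  h.existsUnique_idempotent.choose

end HeckeKiselman

/-!
Two facts carry the theorem: the content of an idempotent is always acyclic, so the idempotents of
`HK Θ` are exactly the `e_X` with `X ∈ A_Θ`; and, for `X, Y ∈ A_Θ`, the product `e_X e_Y` is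
idempotent if and only if `p(X, Y)` holds (`isIdempotentElem_idem_mul_idem`), in which case it is
the absorbing element `e_{X ∪ Y}`. Commuting idempotents have idempotent products in both orders,
and `e f e = f e f = e f` for idempotents makes `e f` idempotent, so the defining relations
translate into conditions on the contents. Conversely, once the products are known to be
`e_{X ∪ Y}`, the relations between the images follow by absorption.

That an element is *not* idempotent is detected by update dynamics. Fix a set `S` and, for each
vertex `i`, a rule computing a value in `S` from the values at the sources of the arrows into `i`.
Letting `x_i` overwrite the value at `i` by the value of the rule defines a right action of `HK Θ`
on `V → S`, as any family of such rules respects the defining relations (`update_action`). For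
monotone rules and a state that updates can only increase, an idempotent leads to a state fixed by
the rules at all vertices of its content (`exists_fixed_of_isIdempotentElem`). The rule "one more
than the sum over the in-neighbours" cannot be fixed along an oriented cycle. The rule that
propagates a signal emitted at `b` along arrows shows that a path
`b → i₁ → ⋯ → i_r → a` forbidden by `p(X, Y)` prevents `e_X e_Y` from being idempotent: the signal
has to reach `a`, but `e_X` acts before `b` is switched on, and `e_Y` does not touch `a`.

That `p(X, Y)` makes `e_X e_Y` idempotent is shown by writing `e_Y = e_{Y \ U} e_U`, where `U` is
the set of vertices of `Y` reachable from `Y \ X` inside `Y`. As `Y \ U ⊆ X`, the product is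
`e_X e_U`, and no arrow leads from `U` to `X \ Y`, so that it absorbs the letters of `X \ Y` too.
-/

namespace HeckeKiselman

/-! ### Words and contents -/

theorem content_mul {V : Type*} [DecidableEq V] {Θ : Digraph V} (x y : HK Θ) :
    content (x * y) = content x ∪ content y := by
  obtain ⟨l, rfl⟩ := exists_ofList x
  obtain ⟨l', rfl⟩ := exists_ofList y
  rw [← ofList_append, content_ofList, content_ofList, content_ofList, List.toFinset_append]

/-- An element that absorbs letters on the right absorbs every word in these letters. -/
theorem mul_ofList_eq {V : Type*} {Θ : Digraph V} {e : HK Θ} {u : List V}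
    (h : ∀ a ∈ u, e * gen Θ a = e) :
    e * ofList Θ u = e := by
  induction u with
  | nil => simp [ofList]
  | cons a u ih =>
    rw [ofList_cons, ← mul_assoc, h a List.mem_cons_self,
      ih fun c hc => h c (List.mem_cons_of_mem _ hc)]

theorem ofList_mul_eq {V : Type*} {Θ : Digraph V} {e : HK Θ} {u : List V}
    (h : ∀ a ∈ u, gen Θ a * e = e) :
    ofList Θ u * e = e := by
  induction u with
  | nil => simp [ofList]
  | cons a u ih =>
    rw [ofList_cons, mul_assoc, ih fun c hc => h c (List.mem_cons_of_mem _ hc),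
      h a List.mem_cons_self]

/-! ### The idempotents `e_X` -/

section Idem

variable {V : Type*} [Finite V] [DecidableEq V] {Θ : Digraph V}

theorem isIdempotentElem_idem {X : Finset V} (h : IsAcyclicOn Θ X) :
    IsIdempotentElem (idem Θ X h) :=
  h.existsUnique_idempotent.choose_spec.1.1

theorem content_idem {X : Finset V} (h : IsAcyclicOn Θ X) : content (idem Θ X h) = X :=
  h.existsUnique_idempotent.choose_spec.1.2

theorem eq_idem {X : Finset V} (h : IsAcyclicOn Θ X) {e : HK Θ} (he : IsIdempotentElem e)
    (hc : content e = X) : e = idem Θ X h :=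
  h.existsUnique_idempotent.choose_spec.2 e ⟨he, hc⟩

theorem exists_idem_eq_ofList {X : Finset V} (h : IsAcyclicOn Θ X) :
    ∃ l : List V, l.toFinset = X ∧ idem Θ X h = ofList Θ l := by
  obtain ⟨l, hl⟩ := exists_ofList (idem Θ X h)
  exact ⟨l, by rw [← content_ofList (Θ := Θ), ← hl, content_idem], hl⟩

theorem gen_mul_idem {X : Finset V} (h : IsAcyclicOn Θ X) {a : V} (ha : a ∈ X) :
    gen Θ a * idem Θ X h = idem Θ X h := by
  simpa [ofList] using
    h.gen_mul_idempotent (isIdempotentElem_idem h) (content_idem h) a ha [] (by simp)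

/-- The right-hand counterpart of `gen_mul_idem`, read off from the absorbing word, which represents
`e_X` by uniqueness. -/
theorem idem_mul_gen {X : Finset V} (h : IsAcyclicOn Θ X) {a : V} (ha : a ∈ X) :
    idem Θ X h * gen Θ a = idem Θ X h := by
  obtain ⟨l, hl, habs⟩ := h.exists_absorbing
  have hmul : ∀ u : List V, (∀ c ∈ u, c ∈ X) → ofList Θ l * ofList Θ u = ofList Θ l := by
    intro u hu
    induction u with
    | nil => simp [ofList]
    | cons c u ih =>
      rw [ofList_cons, ← mul_assoc, (habs c (hu c List.mem_cons_self)).2,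
        ih (fun d hd => hu d (List.mem_cons_of_mem _ hd))]
  have hidem : IsIdempotentElem (ofList Θ l) :=
    hmul l (fun c hc => hl ▸ List.mem_toFinset.2 hc)
  rw [← eq_idem h hidem (by rw [content_ofList, hl]), (habs a ha).2]

theorem mul_idem_eq {X : Finset V} (h : IsAcyclicOn Θ X) {e : HK Θ}
    (he : ∀ a ∈ X, e * gen Θ a = e) : e * idem Θ X h = e := by
  obtain ⟨l, hl, hl'⟩ := exists_idem_eq_ofList h
  rw [hl']
  exact mul_ofList_eq fun a ha => he a (hl ▸ List.mem_toFinset.2 ha)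

theorem idem_mul_eq {X : Finset V} (h : IsAcyclicOn Θ X) {e : HK Θ}
    (he : ∀ a ∈ X, gen Θ a * e = e) : idem Θ X h * e = e := by
  obtain ⟨l, hl, hl'⟩ := exists_idem_eq_ofList h
  rw [hl']
  exact ofList_mul_eq fun a ha => he a (hl ▸ List.mem_toFinset.2 ha)

theorem idem_mul_idem_mul_gen {X Y : Finset V} (hX : IsAcyclicOn Θ X) (hY : IsAcyclicOn Θ Y)
    {a : V} (ha : a ∈ X) (h : ∀ b ∈ Y, ¬ Θ.Adj b a) :
    idem Θ X hX * idem Θ Y hY * gen Θ a = idem Θ X hX * idem Θ Y hY := by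
  obtain ⟨l, hl, hl'⟩ := exists_idem_eq_ofList hY
  have hcan := cancel_right (Θ := Θ) a l fun b hb => h b (hl ▸ List.mem_toFinset.2 hb)
  -- Borrow a copy of `x_a` from `e_X`, so that the final `x_a` can be cancelled against it.
  calc idem Θ X hX * idem Θ Y hY * gen Θ a
      = idem Θ X hX * gen Θ a * ofList Θ l * gen Θ a := by rw [idem_mul_gen hX ha, hl']
    _ = idem Θ X hX * (gen Θ a * ofList Θ l * gen Θ a) := by simp only [mul_assoc]
    _ = idem Θ X hX * gen Θ a * ofList Θ l := by rw [hcan, mul_assoc]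
    _ = _ := by rw [idem_mul_gen hX ha, hl']

theorem isIdempotentElem_idem_mul_idem_of_absorb {X Y : Finset V} (hX : IsAcyclicOn Θ X)
    (hY : IsAcyclicOn Θ Y)
    (h : ∀ a ∈ X, idem Θ X hX * idem Θ Y hY * gen Θ a = idem Θ X hX * idem Θ Y hY) :
    IsIdempotentElem (idem Θ X hX * idem Θ Y hY) := by
  rw [IsIdempotentElem, ← mul_assoc, mul_idem_eq hX h, mul_assoc,
    (isIdempotentElem_idem hY).eq]

/-- If no arrow leads from `U` to `Y \ U`, then `e_Y = e_{Y \ U} e_U`. -/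
theorem idem_eq_sdiff_mul {Y U : Finset V} (hY : IsAcyclicOn Θ Y) (hU : U ⊆ Y)
    (h : ∀ b ∈ U, ∀ a ∈ Y \ U, ¬ Θ.Adj b a) :
    idem Θ Y hY = idem Θ (Y \ U) (hY.mono Finset.sdiff_subset) * idem Θ U (hY.mono hU) := by
  refine (eq_idem hY (isIdempotentElem_idem_mul_idem_of_absorb _ _ fun a ha =>
    idem_mul_idem_mul_gen _ _ ha fun b hb => h b hb a ha) ?_).symm
  rw [content_mul, content_idem, content_idem, Finset.sdiff_union_of_subset hU]

/-- The set `U` of vertices of `Y` reachable from `Y \ X` inside `Y` is split off `e_Y`; the rest of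
`e_Y` is absorbed by `e_X`, and no arrow leads from `U` to `X \ Y`. -/
theorem isIdempotentElem_idem_mul_idem_of_p {X Y : Finset V} (hX : IsAcyclicOn Θ X)
    (hY : IsAcyclicOn Θ Y) (hp : p Θ X Y) :
    IsIdempotentElem (idem Θ X hX * idem Θ Y hY) := by
  classical
  -- After its start, the path may be taken inside `X ∩ Y`, by restarting it at its last vertex
  -- outside `X`.
  let U : Finset V := Y.filter fun c => ∃ b ∈ Y \ X, ∃ l : List V,
    (∀ i ∈ l, i ∈ X ∩ Y) ∧ List.IsChain Θ.Adj (b :: l) ∧ (b :: l).getLast? = some c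
  have hYX : ∀ c ∈ Y \ X, c ∈ U := fun c hc =>
    Finset.mem_filter.2 ⟨(Finset.mem_sdiff.1 hc).1, c, hc, [], by simp⟩
  have hsnoc : ∀ {b c a : V} {l : List V}, List.IsChain Θ.Adj (b :: l) →
      (b :: l).getLast? = some c → Θ.Adj c a → List.IsChain Θ.Adj (b :: (l ++ [a])) := by
    intro b c a l hl hlast hca
    rw [← List.cons_append, List.isChain_append]
    refine ⟨hl, by simp, ?_⟩
    intro x hx y hy
    rw [hlast] at hx
    simp at hx hy
    subst hx hy
    exact hca
  have hUX : ∀ c ∈ U, ∀ a ∈ X \ Y, ¬ Θ.Adj c a := by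
    intro c hc a ha hca
    obtain ⟨-, b, hb, l, hl, hchain, hlast⟩ := Finset.mem_filter.1 hc
    exact hp ⟨b, hb, a, ha, l, hl, hsnoc hchain hlast hca⟩
  have hUY : ∀ c ∈ U, ∀ a ∈ Y \ U, ¬ Θ.Adj c a := by
    intro c hc a ha hca
    obtain ⟨haY, haU⟩ := Finset.mem_sdiff.1 ha
    obtain ⟨-, b, hb, l, hl, hchain, hlast⟩ := Finset.mem_filter.1 hc
    by_cases haX : a ∈ X
    · refine haU (Finset.mem_filter.2 ⟨haY, b, hb, l ++ [a], ?_, hsnoc hchain hlast hca, ?_⟩)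
      · intro i hi
        rcases List.mem_append.1 hi with hi | hi
        · exact hl i hi
        · rw [List.mem_singleton.1 hi]
          exact Finset.mem_inter.2 ⟨haX, haY⟩
      · rw [← List.cons_append, List.getLast?_concat]
    · exact haU (hYX a (Finset.mem_sdiff.2 ⟨haY, haX⟩))
  have hU : U ⊆ Y := Finset.filter_subset _ _
  have hprod : idem Θ X hX * idem Θ Y hY = idem Θ X hX * idem Θ U (hY.mono hU) := by
    have habs : idem Θ X hX * idem Θ (Y \ U) (hY.mono Finset.sdiff_subset) = idem Θ X hX := by
      refine mul_idem_eq _ fun a ha => ?_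
      obtain ⟨haY, haU⟩ := Finset.mem_sdiff.1 ha
      exact idem_mul_gen hX (by_contra fun haX => haU (hYX a (Finset.mem_sdiff.2 ⟨haY, haX⟩)))
    rw [idem_eq_sdiff_mul hY hU hUY, ← mul_assoc, habs]
  refine isIdempotentElem_idem_mul_idem_of_absorb hX hY fun a ha => ?_
  by_cases haY : a ∈ Y
  · rw [mul_assoc, idem_mul_gen hY haY]
  · rw [hprod]
    exact idem_mul_idem_mul_gen hX _ ha fun c hc => hUX c hc a (Finset.mem_sdiff.2 ⟨ha, haY⟩)

end Idem

/-! ### Update dynamics -/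

section Dynamics

variable {V S : Type*} [DecidableEq V]

/-- The state obtained from `v : V → S` by overwriting the value at each letter `i` of the word
in turn, the leftmost letter first, by the value of the rule `F i` at the current state. -/
def run (F : V → (V → S) → S) (l : List V) (v : V → S) : V → S :=
  l.foldl (fun w i => Function.update w i (F i w)) v

theorem run_cons (F : V → (V → S) → S) (a : V) (l : List V) (v : V → S) :
    run F (a :: l) v = run F l (Function.update v a (F a v)) := rfl

theorem run_append (F : V → (V → S) → S) (l l' : List V) (v : V → S) :
    run F (l ++ l') v = run F l' (run F l v) := by
  simp [run]

theorem run_eq_of_notMem (F : V → (V → S) → S) {l : List V} {a : V} (ha : a ∉ l)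
    (v : V → S) : run F l v a = v a := by
  induction l generalizing v with
  | nil => rfl
  | cons b l ih =>
    rw [List.mem_cons, not_or] at ha
    rw [run_cons, ih ha.2, Function.update_of_ne ha.1]

/-- Rules depending only on in-neighbours define a right action of `HK Θ`, so that the effect of a
word depends only on the element that it represents. -/
theorem update_action {Θ : Digraph V} (hΘ : IsSimpleOriented Θ) {F : V → (V → S) → S}
    (hF : ∀ i v w, (∀ j, Θ.Adj j i → v j = w j) → F i v = F i w) {l l' : List V}
    (h : ofList Θ l = ofList Θ l') (v : V → S) : run F l v = run F l' v := by
  have hupd : ∀ i j v x, ¬ Θ.Adj j i → F i (Function.update v j x) = F i v := by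
    intro i j v x hji
    refine hF i _ _ fun k hk => Function.update_of_ne ?_ _ _
    rintro rfl
    exact hji hk
  let g : V → (Function.End (V → S))ᵐᵒᵖ := fun i => MulOpposite.op fun w =>
    Function.update w i (F i w)
  have hrel : ∀ a b, Rel Θ a b → FreeMonoid.lift g a = FreeMonoid.lift g b := by
    intro a b hab
    apply MulOpposite.unop_injective
    funext w
    cases hab with
    | idem i =>
      change Function.update (Function.update w i (F i w)) i
        (F i (Function.update w i (F i w))) = Function.update w i (F i w)
      rw [hupd _ _ _ _ (hΘ.no_loop i), Function.update_idem]
    | comm i j hij =>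
      change Function.update (Function.update w i (F i w)) j
        (F j (Function.update w i (F i w))) = Function.update (Function.update w j (F j w)) i
        (F i (Function.update w j (F j w)))
      rw [hupd _ _ _ _ hij.2.1, hupd _ _ _ _ hij.2.2, Function.update_comm hij.1]
    | braid_left i j hij =>
      have hji := hΘ.no_two_cycle i j hij
      have hne : i ≠ j := fun e => hΘ.no_loop i (e ▸ hij)
      change Function.update (Function.update (Function.update w i (F i w)) j
        (F j (Function.update w i (F i w)))) i (F i (Function.update (Function.update w i (F i w)) j
        (F j (Function.update w i (F i w))))) = Function.update (Function.update w i (F i w)) j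
        (F j (Function.update w i (F i w)))
      rw [hupd _ _ _ _ hji, hupd _ _ _ _ (hΘ.no_loop i), Function.update_comm hne.symm,
        Function.update_idem]
    | braid_right i j hij =>
      have hji := hΘ.no_two_cycle i j hij
      have hne : i ≠ j := fun e => hΘ.no_loop i (e ▸ hij)
      change Function.update (Function.update (Function.update w j (F j w)) i
        (F i (Function.update w j (F j w)))) j (F j (Function.update (Function.update w j (F j w)) i
        (F i (Function.update w j (F j w))))) = Function.update (Function.update w i (F i w)) j
        (F j (Function.update w i (F i w)))
      rw [hupd _ _ _ _ hji, Function.update_comm (β := fun _ => S) hne.symm (F j w) (F i w),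
        hupd _ _ _ _ (hΘ.no_loop j), Function.update_idem]
  have hact : ∀ l : List V, ∀ v, MulOpposite.unop (PresentedMonoid.lift g hrel (ofList Θ l)) v
      = run F l v := by
    intro l
    induction l with
    | nil => intro v; simp only [ofList, List.map_nil, List.prod_nil, map_one]; rfl
    | cons a l ih =>
      intro v
      rw [ofList_cons, map_mul, run_cons, ← ih]
      rfl
  rw [← hact, ← hact, h]

variable [PartialOrder S] {F : V → (V → S) → S}

theorem le_update {v : V → S} (hv : ∀ i, v i ≤ F i v) (a : V) :
    v ≤ Function.update v a (F a v) :=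
  le_update_iff.2 ⟨hv a, fun _ _ => le_rfl⟩

theorem update_le_rule (hF : ∀ i, Monotone (F i)) {v : V → S} (hv : ∀ i, v i ≤ F i v) (a : V)
    (i : V) : Function.update v a (F a v) i ≤ F i (Function.update v a (F a v)) := by
  have hle := le_update hv a
  by_cases hia : i = a
  · subst hia
    rw [Function.update_self]
    exact hF i hle
  · rw [Function.update_of_ne hia]
    exact (hv i).trans (hF i hle)

theorem run_le_rule (hF : ∀ i, Monotone (F i)) (l : List V) {v : V → S}
    (hv : ∀ i, v i ≤ F i v) (i : V) : run F l v i ≤ F i (run F l v) := by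
  induction l generalizing v with
  | nil => exact hv i
  | cons a l ih => exact ih (update_le_rule hF hv a)

theorem le_run (hF : ∀ i, Monotone (F i)) (l : List V) {v : V → S}
    (hv : ∀ i, v i ≤ F i v) : v ≤ run F l v := by
  induction l generalizing v with
  | nil => exact le_rfl
  | cons a l ih => exact (le_update hv a).trans (ih (update_le_rule hF hv a))

theorem rule_eq_of_run_eq (hF : ∀ i, Monotone (F i)) {l : List V} {v : V → S}
    (hv : ∀ i, v i ≤ F i v) (h : run F l v = v) : ∀ k ∈ l, F k v = v k := by
  induction l with
  | nil => simp
  | cons a l ih =>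
    rw [run_cons] at h
    -- The states increase along the word and return to `v`, hence they are all equal to `v`.
    have ha : Function.update v a (F a v) = v :=
      le_antisymm ((le_run hF l (update_le_rule hF hv a)).trans h.le) (le_update hv a)
    rw [ha] at h
    intro k hk
    rcases List.mem_cons.1 hk with rfl | hk
    · simpa using congrFun ha k
    · exact ih h k hk

/-- For monotone rules, a word representing an idempotent turns an initial state which the rules
can only increase into a state fixed by the rules at all letters of the word. -/
theorem exists_fixed_of_isIdempotentElem {Θ : Digraph V} (hΘ : IsSimpleOriented Θ)
    (hloc : ∀ i v w, (∀ j, Θ.Adj j i → v j = w j) → F i v = F i w) (hF : ∀ i, Monotone (F i))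
    {v : V → S} (hv : ∀ i, v i ≤ F i v) {l : List V} (he : IsIdempotentElem (ofList Θ l)) :
    ∀ k ∈ l, F k (run F l v) = run F l v k := by
  refine rule_eq_of_run_eq hF (run_le_rule hF l hv) ?_
  rw [← run_append]
  exact update_action hΘ hloc (by rw [ofList_append, he.eq]) v

end Dynamics

/-! ### Idempotents and their products -/

section Products

variable {V : Type*} [DecidableEq V] {Θ : Digraph V}

/-- After `l`, no signal emitted at `b ∉ l` is present, and `l'` does not touch the end `a` of a
forbidden path; but in the fixed state of an idempotent the signal has travelled along the path. -/
theorem p_of_isIdempotentElem (hΘ : IsSimpleOriented Θ) {l l' : List V}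
    (he : IsIdempotentElem (ofList Θ l * ofList Θ l')) : p Θ l.toFinset l'.toFinset := by
  rintro ⟨b, hb, a, ha, m, hm, hchain⟩
  simp only [Finset.mem_sdiff, List.mem_toFinset] at hb ha
  simp only [Finset.mem_inter, List.mem_toFinset] at hm
  -- A signal emitted at `b` and propagated along arrows.
  let F : V → (V → Prop) → Prop := fun i v => i = b ∨ ∃ j, Θ.Adj j i ∧ v j
  rw [← ofList_append] at he
  have hfix := exists_fixed_of_isIdempotentElem (F := F) (v := fun _ => False) hΘ
    (fun i v w h => by
      have : ∀ j, (Θ.Adj j i ∧ v j) = (Θ.Adj j i ∧ w j) := fun j =>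
        propext (and_congr_right fun hj => by rw [h j hj])
      simp only [F, this])
    (fun i v w h => Or.imp_right fun ⟨j, hj, hvj⟩ => ⟨j, hj, h j hvj⟩)
    (fun _ => False.elim) he
  -- Without the letter `b`, no signal is emitted.
  have hoff : ∀ u : List V, b ∉ u → run F u (fun _ => False) = fun _ => False := by
    intro u hu
    induction u with
    | nil => rfl
    | cons c u ih =>
      rw [List.mem_cons, not_or] at hu
      have hc : F c (fun _ => False) = False := by simp [F, Ne.symm hu.1]
      have hself : Function.update (fun _ : V => False) c False = fun _ => False :=
        Function.update_eq_self c _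
      rw [run_cons, hc, hself]
      exact ih hu.2
  have hfalse : ¬ run F (l ++ l') (fun _ => False) a := by
    rw [run_append, hoff l hb.2, run_eq_of_notMem F ha.2]
    exact id
  have hon : ∀ (u : List V) (c : V), run F (l ++ l') (fun _ => False) c →
      List.IsChain Θ.Adj (c :: u) → (∀ i ∈ u, i ∈ l ++ l') →
      ∀ i ∈ u, run F (l ++ l') (fun _ => False) i := by
    intro u
    induction u with
    | nil => simp
    | cons d u ih =>
      intro c hc hch hu
      rw [List.isChain_cons_cons] at hch
      have hd : run F (l ++ l') (fun _ => False) d := by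
        rw [← hfix d (hu d List.mem_cons_self)]
        exact Or.inr ⟨c, hch.1, hc⟩
      intro i hi
      rcases List.mem_cons.1 hi with rfl | hi
      · exact hd
      · exact ih d hd hch.2 (fun i hi => hu i (List.mem_cons_of_mem _ hi)) i hi
  have hbon : run F (l ++ l') (fun _ => False) b := by
    rw [← hfix b (List.mem_append_right _ hb.1)]
    exact Or.inl rfl
  refine hfalse (hon (m ++ [a]) b hbon hchain ?_ a (by simp))
  intro i hi
  rcases List.mem_append.1 hi with hi | hi
  · exact List.mem_append_left _ (hm i hi).1
  · rw [List.mem_singleton.1 hi]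
    exact List.mem_append_left _ ha.1

variable [Finite V]

/-- The rule "one more than the sum over the in-neighbours" makes the fixed state strictly
increasing along the arrows inside the content. -/
theorem isAcyclicOn_content_of_isIdempotentElem (hΘ : IsSimpleOriented Θ) {e : HK Θ}
    (he : IsIdempotentElem e) : IsAcyclicOn Θ (content e) := by
  classical
  have := Fintype.ofFinite V
  obtain ⟨l, rfl⟩ := exists_ofList e
  rw [content_ofList]
  let F : V → (V → ℕ) → ℕ := fun i v => 1 + ∑ j ∈ Finset.univ.filter (fun j => Θ.Adj j i), v j
  have hfix := exists_fixed_of_isIdempotentElem (F := F) (v := fun _ => 0) hΘ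
    (fun i v w h => congrArg (1 + ·)
      (Finset.sum_congr rfl fun j hj => h j (Finset.mem_filter.1 hj).2))
    (fun i v w h => Nat.add_le_add_left (Finset.sum_le_sum fun j _ => h j) 1)
    (fun _ => Nat.zero_le _) he
  have hlt : ∀ a b, (a ∈ l.toFinset ∧ b ∈ l.toFinset ∧ Θ.Adj a b) →
      run F l (fun _ => 0) a < run F l (fun _ => 0) b := by
    rintro a b ⟨-, hb, hab⟩
    rw [← hfix b (List.mem_toFinset.1 hb), Nat.lt_iff_add_one_le, add_comm]
    exact Nat.add_le_add_left (Finset.single_le_sum (f := run F l fun _ => 0)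
      (fun _ _ => Nat.zero_le _) (Finset.mem_filter.2 ⟨Finset.mem_univ a, hab⟩)) 1
  intro i hi
  have hii := hi.lift (p := (· < ·)) (run F l fun _ => 0) hlt
  rw [Relation.transGen_eq_self] at hii
  exact lt_irrefl _ hii

theorem isIdempotentElem_idem_mul_idem (hΘ : IsSimpleOriented Θ) {X Y : Finset V}
    (hX : IsAcyclicOn Θ X) (hY : IsAcyclicOn Θ Y) :
    IsIdempotentElem (idem Θ X hX * idem Θ Y hY) ↔ p Θ X Y := by
  refine ⟨fun he => ?_, isIdempotentElem_idem_mul_idem_of_p hX hY⟩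
  obtain ⟨l, rfl, hl⟩ := exists_idem_eq_ofList hX
  obtain ⟨l', rfl, hl'⟩ := exists_idem_eq_ofList hY
  rw [hl, hl'] at he
  exact p_of_isIdempotentElem hΘ he

theorem isAcyclicOn_union (hΘ : IsSimpleOriented Θ) {X Y : Finset V}
    (hX : IsAcyclicOn Θ X) (hY : IsAcyclicOn Θ Y) (hp : p Θ X Y) : IsAcyclicOn Θ (X ∪ Y) := by
  have := isAcyclicOn_content_of_isIdempotentElem hΘ (isIdempotentElem_idem_mul_idem_of_p hX hY hp)
  rwa [content_mul, content_idem, content_idem] at this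

theorem idem_mul_idem (hΘ : IsSimpleOriented Θ) {X Y : Finset V} (hX : IsAcyclicOn Θ X)
    (hY : IsAcyclicOn Θ Y) (hp : p Θ X Y) :
    idem Θ X hX * idem Θ Y hY = idem Θ (X ∪ Y) (isAcyclicOn_union hΘ hX hY hp) :=
  eq_idem _ (isIdempotentElem_idem_mul_idem_of_p hX hY hp)
    (by rw [content_mul, content_idem, content_idem])

end Products

end HeckeKiselman

open HeckeKiselman in
theorem mainTheorem2 (n : ℕ) (Θ : Digraph (Fin n)) (hΘ : HeckeKiselman.IsSimpleOriented Θ)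
    (φ : Set.range (HeckeKiselman.gen Θ) → HeckeKiselman.HK Θ) :
    (∃ f : Monoid.End (HeckeKiselman.HK Θ), ∀ g : Set.range (HeckeKiselman.gen Θ), f g.1 = φ g) ↔
    ∃ (X : Fin n → Finset (Fin n)) (hX : ∀ i, HeckeKiselman.IsAcyclicOn Θ (X i)),
      (∀ i, φ ⟨HeckeKiselman.gen Θ i, Set.mem_range_self i⟩ =
        HeckeKiselman.idem Θ (X i) (hX i)) ∧
      (∀ i j, HeckeKiselman.Disconnected Θ i j →
        HeckeKiselman.p Θ (X i) (X j) ∧ HeckeKiselman.p Θ (X j) (X i)) ∧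
      (∀ i j, Θ.Adj i j → HeckeKiselman.p Θ (X i) (X j)) := by
  constructor
  · rintro ⟨f, hf⟩
    have hidem : ∀ i, IsIdempotentElem (f (gen Θ i)) := fun i => by
      rw [IsIdempotentElem, ← map_mul, gen_idem]
    have hX := fun i => isAcyclicOn_content_of_isIdempotentElem hΘ (hidem i)
    have heq : ∀ i, f (gen Θ i) = idem Θ _ (hX i) := fun i => eq_idem (hX i) (hidem i) rfl
    have hp : ∀ i j, IsIdempotentElem (gen Θ i * gen Θ j) →
        p Θ (content (f (gen Θ i))) (content (f (gen Θ j))) := by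
      intro i j hij
      rw [← isIdempotentElem_idem_mul_idem hΘ (hX i) (hX j), ← heq, ← heq, ← map_mul,
        IsIdempotentElem, ← map_mul, hij.eq]
    have hcomm : ∀ i j, Disconnected Θ i j → IsIdempotentElem (gen Θ i * gen Θ j) :=
      fun i j hij => IsIdempotentElem.mul_of_commute (gen_comm hij) (gen_idem i) (gen_idem j)
    refine ⟨fun i => content (f (gen Θ i)), hX, fun i => (hf _).symm.trans (heq i),
      fun i j hij => ⟨hp i j (hcomm i j hij), hp j i (gen_comm hij ▸ hcomm i j hij)⟩,
      fun i j hij => hp i j ?_⟩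
    rw [IsIdempotentElem, ← mul_assoc, gen_braid_left hij, mul_assoc, gen_idem]
  · rintro ⟨X, hX, hφ, hcomm, hadj⟩
    have hrel : ∀ a b, Rel Θ a b → FreeMonoid.lift (fun i => idem Θ (X i) (hX i)) a =
        FreeMonoid.lift (fun i => idem Θ (X i) (hX i)) b := by
      intro a b hab
      cases hab with
      | idem i =>
        simpa only [map_mul, FreeMonoid.lift_eval_of] using (isIdempotentElem_idem (hX i)).eq
      | comm i j hij =>
        simp only [map_mul, FreeMonoid.lift_eval_of]
        rw [idem_mul_idem hΘ _ _ (hcomm i j hij).1, idem_mul_idem hΘ _ _ (hcomm i j hij).2]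
        simp only [Finset.union_comm]
      | braid_left i j hij =>
        simp only [map_mul, FreeMonoid.lift_eval_of]
        rw [idem_mul_idem hΘ _ _ (hadj i j hij)]
        exact mul_idem_eq _ fun a ha => idem_mul_gen _ (Finset.mem_union_left _ ha)
      | braid_right i j hij =>
        simp only [map_mul, FreeMonoid.lift_eval_of]
        rw [mul_assoc, idem_mul_idem hΘ _ _ (hadj i j hij)]
        exact idem_mul_eq _ fun a ha => gen_mul_idem _ (Finset.mem_union_right _ ha)
    refine ⟨PresentedMonoid.lift _ hrel, ?_⟩
    rintro ⟨-, i, rfl⟩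
    exact (PresentedMonoid.lift_of _ hrel).trans (hφ i).symm
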